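/- A graph $H$ is a \emph{threshold graph} if there are $s\in\mathbb{R}$ and $w:V(H)\to\mathbb{R}$ such that distinct vertices $u,v$ are adjacent if and only if $w(u)+w(v)\ge s$. The \emph{threshold dimension} $t(G)$ of a finite graph $G$ is the minimum number of threshold subgraphs of $G$ whose edge sets together cover $E(G)$. A graph is a \emph{split graph} if its vertex set can be partitioned into a clique and an independent set. Let $b>1$ be any fixed real number and let $\log$ denote the logarithm to base $b$. There is a polynomial-time $2\left\lceil \frac{n\sqrt{\log\log n}}{\sqrt{\log n}}\right\rceil$-factor approximation algorithm for the threshold dimension of split graphs on $n$ vertices. That is, there are a program for a random access machine (with unit cost, and with addition and truncated subtraction as its arithmetic) and a polynomial $p$ such that, given the number $n$ and the adjacency matrix of any split graph $G$ on the vertex set $\{0,\dots,n-1\}$, the program halts after at most $p(n)$ steps and outputs a natural number $A(G)$ with $t(G)\le A(G)$ and, whenever $n>b$ (that is, whenever $\log\log n$ is defined and positive), $$A(G)\le 2\left\lceil \frac{n\sqrt{\log\log n}}{\sqrt{\log n}}\right\rceil\, t(G).$$ -/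

import Mathlib

namespace SimpleGraph

/-- A split graph: the vertex set is the disjoint union of a clique and an independent set. -/
def IsSplitGraph {V : Type*} (G : SimpleGraph V) : Prop :=
  ∃ K : Set V, G.IsClique K ∧ G.IsIndepSet Kᶜ

/-- A threshold graph: distinct `u`, `v` are adjacent iff `w u + w v ≥ s`, for some real
vertex weights `w` and some real `s`. -/
def IsThresholdGraph {V : Type*} (G : SimpleGraph V) : Prop :=
  ∃ (s : ℝ) (w : V → ℝ), ∀ u v : V, u ≠ v → (G.Adj u v ↔ w u + w v ≥ s)

/-- The edges of `G` can be covered by `k` threshold subgraphs of `G`. Spanning subgraphs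
suffice: adding isolated vertices to a threshold graph gives a threshold graph. -/
def HasThresholdCover {V : Type*} (G : SimpleGraph V) (k : ℕ) : Prop :=
  ∃ T : Fin k → SimpleGraph V,
    (∀ i, T i ≤ G ∧ (T i).IsThresholdGraph) ∧ ∀ u v, G.Adj u v → ∃ i, (T i).Adj u v

/-- The threshold dimension `t(G)` : the minimum number of threshold subgraphs of `G` needed to
cover the edges of `G`. -/
noncomputable def thresholdDimension {V : Type*} (G : SimpleGraph V) : ℕ :=
  sInf {k | G.HasThresholdCover k}

/-- The subgraph of `G` with the single possible edge `xy` is a threshold graph. -/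
theorem isThresholdGraph_inf_edge {V : Type*} (G : SimpleGraph V) (x y : V) :
    (G ⊓ SimpleGraph.edge x y).IsThresholdGraph := by
  classical
  by_cases h : G.Adj x y
  · refine ⟨2, fun v => if v = x ∨ v = y then 1 else 0, fun u v huv => ?_⟩
    rw [SimpleGraph.inf_adj, SimpleGraph.edge_adj]
    constructor
    · rintro ⟨-, (⟨rfl, rfl⟩ | ⟨rfl, rfl⟩), -⟩ <;> norm_num
    · intro h2
      have hu : u = x ∨ u = y := by
        by_contra hu
        simp only [hu, if_false] at h2
        split_ifs at h2 <;> norm_num at h2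
      have hv : v = x ∨ v = y := by
        by_contra hv
        simp only [hv, if_false] at h2
        split_ifs at h2 <;> norm_num at h2
      rcases hu with rfl | rfl <;> rcases hv with rfl | rfl
      · exact absurd rfl huv
      · exact ⟨h, by simp, huv⟩
      · exact ⟨h.symm, by simp, huv⟩
      · exact absurd rfl huv
  · refine ⟨1, fun _ => 0, fun u v huv => ?_⟩
    rw [SimpleGraph.inf_adj, SimpleGraph.edge_adj]
    constructor
    · rintro ⟨h', (⟨rfl, rfl⟩ | ⟨rfl, rfl⟩), -⟩
      · exact absurd h' h
      · exact absurd h'.symm h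
    · intro h'
      norm_num at h'

/-- A finite graph has a threshold cover (one subgraph for each pair of vertices), so that
`thresholdDimension` is a genuine minimum. -/
theorem exists_hasThresholdCover {V : Type*} [Finite V] (G : SimpleGraph V) :
    ∃ k, G.HasThresholdCover k := by
  obtain ⟨k, ⟨e⟩⟩ := Finite.exists_equiv_fin (V × V)
  refine ⟨k, fun i => G ⊓ SimpleGraph.edge (e.symm i).1 (e.symm i).2,
    fun i => ⟨inf_le_left, G.isThresholdGraph_inf_edge _ _⟩, fun u v huv => ⟨e (u, v), ?_⟩⟩
  simp [SimpleGraph.edge_adj, huv, huv.ne]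

end SimpleGraph

/-! A random access machine, programmed by structured programs, with unit cost. A machine state
consists of registers and of one-dimensional arrays, all of whose cells hold natural numbers; a
program names finitely many registers and arrays, and array cells are addressed indirectly. The
arithmetic is addition and truncated subtraction only. There is no multiplication, so that the
bit length of a number grows by at most a constant in each step, and hence the polynomial-time
computations of this model are those of Turing machines. -/

namespace Ram

/-- Machine states: the content of the registers and of the arrays. -/
structure State where
  reg : ℕ → ℕ
  arr : ℕ → ℕ → ℕ

/-- Arithmetic expressions. `read a i` is the cell with address `i` of the array named `a`. -/
inductive Expr where
  | const (c : ℕ) : Expr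
  | reg (x : ℕ) : Expr
  | read (a : ℕ) (i : Expr) : Expr
  | add (e f : Expr) : Expr
  | sub (e f : Expr) : Expr

/-- The value of an expression in a state. -/
def Expr.eval (σ : State) : Expr → ℕ
  | .const c => c
  | .reg x => σ.reg x
  | .read a i => σ.arr a (i.eval σ)
  | .add e f => e.eval σ + f.eval σ
  | .sub e f => e.eval σ - f.eval σ

/-- Programs. In `cond` and `loop`, the test `e` succeeds when its value is not `0`. -/
inductive Prog where
  | skip : Prog
  | assign (x : ℕ) (e : Expr) : Prog
  | store (a : ℕ) (i e : Expr) : Prog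
  | seq (P Q : Prog) : Prog
  | cond (e : Expr) (P Q : Prog) : Prog
  | loop (e : Expr) (P : Prog) : Prog

/-- The state after the register `x` has received the value `c`. -/
def State.setReg (σ : State) (x c : ℕ) : State :=
  { σ with reg := Function.update σ.reg x c }

/-- The state after the cell `i` of the array `a` has received the value `c`. -/
def State.setArr (σ : State) (a i c : ℕ) : State :=
  { σ with arr := Function.update σ.arr a (Function.update (σ.arr a) i c) }

/-- `Exec P σ τ T`: started in the state `σ`, the program `P` halts in the state `τ` after
exactly `T` steps. Each elementary command and each evaluation of a test is one step (the
expressions in a fixed program have bounded size). -/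
inductive Exec : Prog → State → State → ℕ → Prop where
  | skip (σ : State) : Exec .skip σ σ 1
  | assign (x : ℕ) (e : Expr) (σ : State) :
      Exec (.assign x e) σ (σ.setReg x (e.eval σ)) 1
  | store (a : ℕ) (i e : Expr) (σ : State) :
      Exec (.store a i e) σ (σ.setArr a (i.eval σ) (e.eval σ)) 1
  | seq {P Q : Prog} {σ τ υ : State} {S T : ℕ} :
      Exec P σ τ S → Exec Q τ υ T → Exec (.seq P Q) σ υ (S + T)
  | cond_true {e : Expr} {P Q : Prog} {σ τ : State} {T : ℕ} :
      e.eval σ ≠ 0 → Exec P σ τ T → Exec (.cond e P Q) σ τ (T + 1)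
  | cond_false {e : Expr} {P Q : Prog} {σ τ : State} {T : ℕ} :
      e.eval σ = 0 → Exec Q σ τ T → Exec (.cond e P Q) σ τ (T + 1)
  | loop_done {e : Expr} {P : Prog} {σ : State} :
      e.eval σ = 0 → Exec (.loop e P) σ σ 1
  | loop_again {e : Expr} {P : Prog} {σ τ υ : State} {S T : ℕ} :
      e.eval σ ≠ 0 → Exec P σ τ S → Exec (.loop e P) τ υ T →
      Exec (.loop e P) σ υ (S + T + 1)

/-- The machine is deterministic: the final state and the number of steps are unique. -/
theorem Exec.deterministic {P : Prog} {σ τ τ' : State} {T T' : ℕ}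
    (h : Exec P σ τ T) (h' : Exec P σ τ' T') : τ = τ' ∧ T = T' := by
  induction h generalizing τ' T' with
  | skip => cases h'; exact ⟨rfl, rfl⟩
  | assign => cases h'; exact ⟨rfl, rfl⟩
  | store => cases h'; exact ⟨rfl, rfl⟩
  | seq _ _ ih1 ih2 =>
    cases h' with
    | seq a b =>
      obtain ⟨rfl, rfl⟩ := ih1 a
      obtain ⟨rfl, rfl⟩ := ih2 b
      exact ⟨rfl, rfl⟩
  | cond_true hne _ ih =>
    cases h' with
    | cond_true _ a => obtain ⟨rfl, rfl⟩ := ih a; exact ⟨rfl, rfl⟩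
    | cond_false h0 _ => exact absurd h0 hne
  | cond_false h0 _ ih =>
    cases h' with
    | cond_true hne _ => exact absurd h0 hne
    | cond_false _ a => obtain ⟨rfl, rfl⟩ := ih a; exact ⟨rfl, rfl⟩
  | loop_done h0 =>
    cases h' with
    | loop_done => exact ⟨rfl, rfl⟩
    | loop_again hne _ _ => exact absurd h0 hne
  | loop_again hne _ _ ih1 ih2 =>
    cases h' with
    | loop_done h0 => exact absurd h0 hne
    | loop_again _ a b =>
      obtain ⟨rfl, rfl⟩ := ih1 a
      obtain ⟨rfl, rfl⟩ := ih2 b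
      exact ⟨rfl, rfl⟩

open Classical in
/-- The initial state for an input graph `G` with vertices `0, …, n - 1`: register `0` holds `n`,
array `0` holds the adjacency matrix row by row, and all other cells hold `0`. -/
noncomputable def graphInput {n : ℕ} (G : SimpleGraph (Fin n)) : State where
  reg x := if x = 0 then n else 0
  arr a i := if a = 0 ∧ ∃ u v : Fin n, G.Adj u v ∧ i = n * (u : ℕ) + (v : ℕ) then 1 else 0

end Ram

/-! Let a split graph have clique side `K` and independent side `S`. A threshold subgraph meets `K`
in neighbourhoods that are upper sets of `S` for some weighting of `S`, and conversely every
weighting `w` of `S` gives a largest threshold subgraph of this kind. So the threshold dimension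
is, up to the choice of the partition, the least number of weightings of `S` whose upper sets
contained in the neighbourhoods of the vertices of `K` cover all edges between `K` and `S`.

This number does not grow when `S` shrinks, and covers for the parts of `S` can be put together.
Cutting `S` into `n / k + 1` blocks of at most `k` vertices and adding up the exact values for the
blocks therefore loses at most the factor `n / k + 1`. On a block only the order of the weights
matters, so at most `k` weightings with values below `k` have to be considered, and these are the
digits of a number below `k ^ (k * k)`. All these numbers can be tried in polynomial time
if `k ^ (k * k) ≤ n + c`, which allows `k` to be of the order of `√(log n / log log n)`. -/

namespace SplitGraph

open SimpleGraph

section Simplicial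

variable {V : Type*} {G : SimpleGraph V}

/-- A vertex is simplicial if its neighbours are pairwise adjacent. -/
def IsSimplicial (G : SimpleGraph V) (v : V) : Prop :=
  G.IsClique (G.neighborSet v)

/-- The simplicial vertices without a smaller simplicial neighbour. In a split graph they are the
independent side of a split partition, one that can be read off the adjacency matrix. -/
def minSimplicial [LT V] (G : SimpleGraph V) : Set V :=
  {v | IsSimplicial G v ∧ ∀ u < v, IsSimplicial G u → ¬G.Adj v u}

theorem isSimplicial_of_notMem {K : Set V} (hK : G.IsClique K) (hKc : G.IsIndepSet Kᶜ) {v : V}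
    (hv : v ∉ K) : IsSimplicial G v :=
  hK.subset fun _ hu => by_contra fun huK => hKc hv huK hu.ne hu

theorem isIndepSet_minSimplicial [LinearOrder V] (G : SimpleGraph V) :
    G.IsIndepSet (minSimplicial G) := by
  intro u hu v hv hne huv
  rcases hne.lt_or_gt with h | h
  · exact hv.2 u h hu.1 huv.symm
  · exact hu.2 v h hv.1 huv

theorem adj_of_notMem_minSimplicial [LT V] {K : Set V} (hK : G.IsClique K)
    (hKc : G.IsIndepSet Kᶜ) {v x : V} (hv : v ∉ K) (hvm : v ∉ minSimplicial G)
    (hx : x ∈ K ∨ x ∉ minSimplicial G) (hvx : v ≠ x) : G.Adj v x := by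
  have simplicial_nbr : ∀ a ∉ K, a ∉ minSimplicial G → ∃ u ∈ K, IsSimplicial G u ∧ G.Adj a u := by
    intro a ha ham
    have : ∃ u < a, IsSimplicial G u ∧ G.Adj a u := by
      simpa [minSimplicial, isSimplicial_of_notMem hK hKc ha] using ham
    obtain ⟨u, -, hu, hau⟩ := this
    exact ⟨u, by_contra fun huK => hKc ha huK hau.ne hau, hu, hau⟩
  have adj_clique : ∀ a ∉ K, a ∉ minSimplicial G → ∀ y ∈ K, G.Adj a y := by
    intro a ha ham y hy
    obtain ⟨u, huK, hu, hau⟩ := simplicial_nbr a ha ham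
    rcases eq_or_ne u y with rfl | huy
    · exact hau
    · exact hu hau.symm (hK huK hy huy) fun h => ha (h ▸ hy)
  by_cases hxK : x ∈ K
  · exact adj_clique v hv hvm x hxK
  · obtain ⟨u, huK, hu, hvu⟩ := simplicial_nbr v hv hvm
    exact hu hvu.symm (adj_clique x hxK (hx.resolve_left hxK) u huK).symm hvx

theorem isClique_compl_minSimplicial [LT V] (hG : G.IsSplitGraph) :
    G.IsClique (minSimplicial G)ᶜ := by
  obtain ⟨K, hK, hKc⟩ := hG
  intro u hu v hv huv
  by_cases huK : u ∈ K
  · by_cases hvK : v ∈ K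
    · exact hK huK hvK huv
    · exact (adj_of_notMem_minSimplicial hK hKc hvK hv (.inr hu) huv.symm).symm
  · exact adj_of_notMem_minSimplicial hK hKc huK hu (.inr hv) huv

theorem exists_adj_minSimplicial [LinearOrder V] [WellFoundedLT V] (hG : G.IsSplitGraph) {v : V}
    (hv : v ∉ minSimplicial G) : ∃ u ∈ minSimplicial G, G.Adj v u := by
  by_cases hvs : IsSimplicial G v
  · have : ∃ u < v, IsSimplicial G u ∧ G.Adj v u := by simpa [minSimplicial, hvs] using hv
    obtain ⟨x, hxv, hx⟩ := this
    obtain ⟨u, ⟨hu, hvu⟩, hmin⟩ :=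
      wellFounded_lt.has_min {u | IsSimplicial G u ∧ G.Adj v u} ⟨x, hx⟩
    refine ⟨u, ⟨hu, fun t htu ht hut => ?_⟩, hvu⟩
    rcases eq_or_ne v t with rfl | hvt
    · exact hmin x hx (hxv.trans htu)
    · exact hmin t ⟨ht, hu hvu.symm hut hvt⟩ htu
  · obtain ⟨x, hx, y, hy, hxy, hnadj⟩ :
        ∃ x, G.Adj v x ∧ ∃ y, G.Adj v y ∧ x ≠ y ∧ ¬G.Adj x y := by
      simpa [IsSimplicial, SimpleGraph.IsClique, Set.Pairwise] using hvs
    by_contra! hnone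
    exact hnadj <|
      isClique_compl_minSimplicial hG (fun h => hnone x h hx) (fun h => hnone y h hy) hxy

end Simplicial

section ChainCover

variable {V ι α : Type*} {G : SimpleGraph V} {K S : Set V}

/-- The vertex weights `w i` cover the edges between `K` and `S` by chain graphs: each edge `vu` is
*exposed* by some `i`, in that `v` is adjacent to all vertices of `S` of weight at least `w i u`. -/
def IsChainCover [LE α] (G : SimpleGraph V) (K S : Set V) (w : ι → V → α) : Prop :=
  ∀ v ∈ K, ∀ u ∈ S, G.Adj v u → ∃ i, ∀ t ∈ S, w i u ≤ w i t → G.Adj v t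

theorem IsChainCover.of_le_imp_le {β : Type*} [LE α] [LE β] {w : ι → V → α} {w' : ι → V → β}
    (h : IsChainCover G K S w) (hw : ∀ i, ∀ u ∈ S, ∀ t ∈ S, w' i u ≤ w' i t → w i u ≤ w i t) :
    IsChainCover G K S w' := fun v hv u hu hvu =>
  (h v hv u hu hvu).imp fun i hi t ht hut => hi t ht (hw i u hu t ht hut)

theorem exists_rank [LinearOrder α] (hS : S.Finite) (w : V → α) :
    ∃ r : V → ℕ, (∀ u ∈ S, r u < S.ncard) ∧ ∀ u ∈ S, ∀ t ∈ S, r u ≤ r t → w u ≤ w t := by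
  refine ⟨fun u => {t ∈ S | w t < w u}.ncard, fun u hu => ?_, fun u _ t ht hut => ?_⟩
  · exact Set.ncard_lt_ncard ⟨Set.sep_subset _ _, fun h => (h hu).2.false⟩ hS
  · by_contra! hlt
    refine hut.not_gt (Set.ncard_lt_ncard ⟨fun x hx => ⟨hx.1, hx.2.trans hlt⟩, fun h => ?_⟩
      (hS.subset (Set.sep_subset _ _)))
    exact (h ⟨ht, hlt⟩).2.false

theorem IsChainCover.exists_rank [LinearOrder α] {w : ι → V → α} (h : IsChainCover G K S w)
    (hS : S.Finite) :
    ∃ r : ι → V → ℕ, IsChainCover G K S r ∧ ∀ i, ∀ u ∈ S, r i u < S.ncard := by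
  choose r hr hrw using fun i => SplitGraph.exists_rank hS (w i)
  exact ⟨r, h.of_le_imp_le hrw, hr⟩

/-- The minimum number of chain graphs needed to cover the edges of `G` between `K` and `S`. -/
noncomputable def chainCoverNumber (G : SimpleGraph V) (K S : Set V) : ℕ :=
  sInf {c | ∃ w : Fin c → V → ℕ, IsChainCover G K S w}

theorem IsChainCover.chainCoverNumber_le [LinearOrder α] {c : ℕ} {w : Fin c → V → α}
    (h : IsChainCover G K S w) (hS : S.Finite) : chainCoverNumber G K S ≤ c := by
  obtain ⟨r, hr, -⟩ := h.exists_rank hS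
  exact Nat.sInf_le ⟨r, hr⟩

theorem exists_isChainCover_ncard (hS : S.Finite) :
    ∃ w : Fin S.ncard → V → ℕ, IsChainCover G K S w := by
  classical
  have := hS.to_subtype
  let e : S ≃ Fin S.ncard := Finite.equivFin S
  refine ⟨fun i t => if t = e.symm i then 1 else 0, fun v _ u hu hvu => ?_⟩
  refine ⟨e ⟨u, hu⟩, fun t _ ht => ?_⟩
  have htu : t = u := by simpa [Nat.one_le_iff_ne_zero] using ht
  exact htu ▸ hvu

theorem chainCoverNumber_le_ncard (hS : S.Finite) : chainCoverNumber G K S ≤ S.ncard :=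
  let ⟨_, hw⟩ := exists_isChainCover_ncard hS
  hw.chainCoverNumber_le hS

theorem exists_isChainCover_chainCoverNumber (hS : S.Finite) :
    ∃ w : Fin (chainCoverNumber G K S) → V → ℕ, IsChainCover G K S w :=
  Nat.sInf_mem (s := {c | ∃ w : Fin c → V → ℕ, IsChainCover G K S w})
    ⟨_, exists_isChainCover_ncard hS⟩

end ChainCover

section ThresholdCover

variable {V : Type*} {G : SimpleGraph V} {K S : Set V}

theorem hasThresholdCover_card {ι : Type*} [Fintype ι] (T : ι → SimpleGraph V)
    (hT : ∀ i, T i ≤ G ∧ (T i).IsThresholdGraph) (hcov : ∀ u v, G.Adj u v → ∃ i, (T i).Adj u v) :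
    G.HasThresholdCover (Fintype.card ι) := by
  refine ⟨fun i => T ((Fintype.equivFin ι).symm i), fun i => hT _, fun u v huv => ?_⟩
  obtain ⟨i, hi⟩ := hcov u v huv
  exact ⟨Fintype.equivFin ι i, by simpa using hi⟩

theorem exists_isChainCover_of_hasThresholdCover {c : ℕ} (h : G.HasThresholdCover c)
    (hKS : Disjoint K S) : ∃ w : Fin c → V → ℝ, IsChainCover G K S w := by
  obtain ⟨T, hT, hcov⟩ := h
  choose s w hw using fun i => (hT i).2
  refine ⟨w, fun v hv u _ hvu => ?_⟩
  obtain ⟨i, hi⟩ := hcov v u hvu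
  refine ⟨i, fun t ht hut => (hT i).1 ((hw i v t (hKS.ne_of_mem hv ht)).2 ?_)⟩
  have := (hw i v u hi.ne).1 hi
  linarith

theorem isThresholdGraph_of_chain {H : SimpleGraph V} (hK : H.IsClique K) (hKc : H.IsIndepSet Kᶜ)
    {τ w : V → ℝ} (hadj : ∀ v ∈ K, ∀ u ∉ K, H.Adj v u ↔ τ v ≤ w u) {M : ℝ}
    (hτ : ∀ v ∈ K, τ v ≤ M) (hw : ∀ u ∉ K, w u < M) : H.IsThresholdGraph := by
  classical
  refine ⟨0, fun v => if v ∈ K then M - τ v else w v - M, fun u v huv => ?_⟩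
  by_cases hu : u ∈ K <;> by_cases hv : v ∈ K <;> simp only [hu, hv, if_true, if_false]
  · exact iff_of_true (hK hu hv huv) (by linarith [hτ u hu, hτ v hv])
  · rw [hadj u hu v hv]
    constructor <;> intro <;> linarith
  · rw [H.adj_comm, hadj v hv u hu]
    constructor <;> intro <;> linarith
  · exact iff_of_false (hKc hu hv huv) (by linarith [hw u hu, hw v hv])

/-- The clique `K` together with a chain graph between `K` and `S`: a vertex `v` of `K` is joined
to the vertices of `S` whose weight is so large that all heavier ones are neighbours of `v` in
`G`. -/
def chainGraph (G : SimpleGraph V) (K S : Set V) (w : V → ℕ) : SimpleGraph V :=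
  fromRel fun v u => v ∈ K ∧ (u ∈ K ∨ u ∈ S ∧ ∀ t ∈ S, w u ≤ w t → G.Adj v t)

theorem chainGraph_le (hK : G.IsClique K) (w : V → ℕ) : chainGraph G K S w ≤ G := by
  intro u v h
  obtain ⟨hne, ⟨hu, hv | ⟨hv, h⟩⟩ | ⟨hv, hu | ⟨hu, h⟩⟩⟩ := (fromRel_adj _ _ _).1 h
  · exact hK hu hv hne
  · exact h v hv le_rfl
  · exact hK hu hv hne
  · exact (h u hu le_rfl).symm

theorem isThresholdGraph_chainGraph (hS : S.Finite) (w : V → ℕ) :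
    (chainGraph G K S w).IsThresholdGraph := by
  classical
  obtain ⟨M, hM⟩ : ∃ M, ∀ t ∈ S, w t < M :=
    ⟨hS.toFinset.sup w + 1, fun t ht => Nat.lt_succ_of_le (Finset.le_sup (by simpa using ht))⟩
  let A : V → Set ℕ := fun v => {a | ∀ t ∈ S, a ≤ w t → G.Adj v t}
  have hMA : ∀ v, M ∈ A v := fun v t ht h => absurd h (hM t ht).not_ge
  have exposed_iff : ∀ v u, (∀ t ∈ S, w u ≤ w t → G.Adj v t) ↔ sInf (A v) ≤ w u := fun v u =>
    ⟨fun h => Nat.sInf_le h, fun h t ht hut => Nat.sInf_mem ⟨M, hMA v⟩ t ht (h.trans hut)⟩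
  refine isThresholdGraph_of_chain (K := K) (M := M) (τ := fun v => (sInf (A v) : ℕ))
    (w := fun u => if u ∈ S then (w u : ℝ) else -1) ?_ ?_ ?_ ?_ ?_
  · exact fun v hv u hu hne => (fromRel_adj _ _ _).2 ⟨hne, .inl ⟨hv, .inl hu⟩⟩
  · rintro v hv u hu - h
    obtain ⟨-, h | h⟩ := (fromRel_adj _ _ _).1 h
    exacts [hv h.1, hu h.1]
  · intro v hv u hu
    have hne : v ≠ u := fun h => hu (h ▸ hv)
    by_cases huS : u ∈ S
    · simp [chainGraph, hne, hv, hu, huS, exposed_iff]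
    · have : (-1 : ℝ) < (sInf (A v) : ℕ) := neg_one_lt_zero.trans_le (Nat.cast_nonneg _)
      simpa [chainGraph, hne, hv, hu, huS] using this
  · exact fun v _ => Nat.cast_le.2 (Nat.sInf_le (hMA v))
  · intro u _
    split_ifs with huS
    · exact Nat.cast_lt.2 (hM u huS)
    · exact neg_one_lt_zero.trans_le (Nat.cast_nonneg _)

theorem hasThresholdCover_sum_of_isChainCover {J : Type*} [Fintype J] {S : J → Set V} {c : J → ℕ}
    {w : ∀ j, Fin (c j) → V → ℕ} (hK : G.IsClique K) (hKc : G.IsIndepSet Kᶜ)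
    (hnbr : ∀ v ∈ K, ∃ u ∉ K, G.Adj v u) (hS : ∀ u ∉ K, ∃ j, u ∈ S j) (hfin : ∀ j, (S j).Finite)
    (hw : ∀ j, IsChainCover G K (S j) (w j)) : G.HasThresholdCover (∑ j, c j) := by
  let T : (Σ j, Fin (c j)) → SimpleGraph V := fun i => chainGraph G K (S i.1) (w i.1 i.2)
  have exists_exposed : ∀ v ∈ K, ∀ u ∉ K, G.Adj v u → ∃ i, (T i).Adj v u := by
    intro v hv u hu hvu
    obtain ⟨j, huj⟩ := hS u hu
    obtain ⟨i, hi⟩ := hw j v hv u huj hvu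
    exact ⟨⟨j, i⟩, (fromRel_adj _ _ _).2 ⟨hvu.ne, .inl ⟨hv, .inr ⟨huj, hi⟩⟩⟩⟩
  have hcov : ∀ u v, G.Adj u v → ∃ i, (T i).Adj u v := by
    intro u v huv
    by_cases hu : u ∈ K <;> by_cases hv : v ∈ K
    · obtain ⟨x, hx, hux⟩ := hnbr u hu
      obtain ⟨i, -⟩ := exists_exposed u hu x hx hux
      exact ⟨i, (fromRel_adj _ _ _).2 ⟨huv.ne, .inl ⟨hu, .inl hv⟩⟩⟩
    · exact exists_exposed u hu v hv huv
    · exact (exists_exposed v hv u hu huv.symm).imp fun i hi => hi.symm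
    · exact absurd huv (hKc hu hv huv.ne)
  have := hasThresholdCover_card T
    (fun i => ⟨chainGraph_le hK _, isThresholdGraph_chainGraph (hfin _) _⟩) hcov
  rwa [Fintype.card_sigma, Finset.sum_congr rfl fun j _ => Fintype.card_fin (c j)] at this

theorem hasThresholdCover_thresholdDimension [Finite V] (G : SimpleGraph V) :
    G.HasThresholdCover G.thresholdDimension :=
  Nat.sInf_mem G.exists_hasThresholdCover

theorem chainCoverNumber_le_thresholdDimension [Finite V] (hKS : Disjoint K S) :
    chainCoverNumber G K S ≤ G.thresholdDimension := by
  obtain ⟨w, hw⟩ :=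
    exists_isChainCover_of_hasThresholdCover (hasThresholdCover_thresholdDimension G) hKS
  exact hw.chainCoverNumber_le S.toFinite

end ThresholdCover

section Blocks

variable {n : ℕ} {G : SimpleGraph (Fin n)}

/-- The vertices of `minSimplicial G` with numbers in `[k * j, k * (j + 1))`. For `k = 0` the block
with `j = 0` is all of `minSimplicial G`. -/
def block (G : SimpleGraph (Fin n)) (k j : ℕ) : Set (Fin n) :=
  {u | u ∈ minSimplicial G ∧ (u : ℕ) / k = j}

theorem ncard_block_le {k : ℕ} (hk : 0 < k) (j : ℕ) : (block G k j).ncard ≤ k := by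
  have hmaps :
      Set.MapsTo (fun u : Fin n => (u : ℕ)) (block G k j) (Set.Ico (k * j) (k * j + k)) := by
    rintro u ⟨-, rfl⟩
    exact ⟨Nat.mul_div_le _ _, Nat.lt_mul_div_succ _ hk⟩
  simpa [Set.ncard_eq_toFinset_card'] using
    Set.ncard_le_ncard_of_injOn _ hmaps (Fin.val_injective.injOn) (Set.finite_Ico _ _)

/-- The output of the algorithm with blocks of size `k`. -/
noncomputable def approx (G : SimpleGraph (Fin n)) (k : ℕ) : ℕ :=
  ∑ j : Fin (n / k + 1), chainCoverNumber G (minSimplicial G)ᶜ (block G k j)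

theorem thresholdDimension_le_approx (hG : G.IsSplitGraph) (k : ℕ) :
    G.thresholdDimension ≤ approx G k := by
  choose w hw using fun j : Fin (n / k + 1) =>
    exists_isChainCover_chainCoverNumber (G := G) (K := (minSimplicial G)ᶜ)
      (block G k j).toFinite
  refine Nat.sInf_le (hasThresholdCover_sum_of_isChainCover (isClique_compl_minSimplicial hG) ?_ ?_
    ?_ (fun _ => Set.toFinite _) hw)
  · rw [compl_compl]
    exact isIndepSet_minSimplicial G
  · intro v hv
    simpa using exists_adj_minSimplicial hG hv
  · intro u hu
    exact ⟨⟨u / k, Nat.lt_succ_of_le (Nat.div_le_div_right u.2.le)⟩, not_not.1 hu, rfl⟩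

theorem approx_le (G : SimpleGraph (Fin n)) (k : ℕ) :
    approx G k ≤ (n / k + 1) * G.thresholdDimension := by
  calc approx G k ≤ ∑ _j : Fin (n / k + 1), G.thresholdDimension :=
        Finset.sum_le_sum fun j _ => chainCoverNumber_le_thresholdDimension <|
          Set.disjoint_left.2 fun _ hu huj => hu huj.1
    _ = (n / k + 1) * G.thresholdDimension := by simp

end Blocks

section Digits

/-- The number `x` encodes weights of the vertices of a block of size `k`: the `i`-th weight of the
vertex `u` is the base-`k` digit of `x` at the place `k * i + u % k`. -/
def digitWeight (k x i u : ℕ) : ℕ :=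
  x / k ^ (k * i + u % k) % k

theorem exists_digits_eq {k N : ℕ} (f : ℕ → ℕ) (hf : ∀ e < N, f e < k) :
    ∃ x < k ^ N, ∀ e < N, x / k ^ e % k = f e := by
  let g : Fin N → Fin k := fun e => ⟨f e, hf e e.2⟩
  refine ⟨finFunctionFinEquiv g, (finFunctionFinEquiv g).2, fun e he => ?_⟩
  exact congrArg Fin.val (congrFun (finFunctionFinEquiv.symm_apply_apply g) ⟨e, he⟩)

variable {n : ℕ} {G : SimpleGraph (Fin n)} {k c : ℕ}

theorem exists_digitWeight_eq (hk : 0 < k) (hc : c ≤ k) {j : ℕ} {r : Fin c → Fin n → ℕ}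
    (hr : ∀ i, ∀ u ∈ block G k j, r i u < k) :
    ∃ x < k ^ (k * k), ∀ i : Fin c, ∀ u ∈ block G k j, digitWeight k x i u = r i u := by
  classical
  let f : ℕ → ℕ := fun e =>
    if h : e / k < c ∧ k * j + e % k < n then r ⟨e / k, h.1⟩ ⟨k * j + e % k, h.2⟩ % k else 0
  obtain ⟨x, hx, hxf⟩ := exists_digits_eq (k := k) (N := k * k) f fun e _ => by
    dsimp only [f]
    split_ifs
    exacts [Nat.mod_lt _ hk, hk]
  refine ⟨x, hx, fun i u hu => ?_⟩
  obtain ⟨-, rfl⟩ := id hu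
  have hmod : (u : ℕ) % k < k := Nat.mod_lt _ hk
  have hlt : k * i + u % k < k * k :=
    calc k * i + u % k < k * (i + 1) := by rw [Nat.mul_succ]; omega
      _ ≤ k * k := Nat.mul_le_mul_left k (i.2.trans_le hc)
  have hdiv : (k * i + u % k) / k = i := by
    rw [Nat.mul_add_div hk, Nat.div_eq_of_lt hmod, add_zero]
  have hu' : k * (u / k) + (k * i + u % k) % k = u := by
    rw [Nat.mul_add_mod, Nat.mod_mod, Nat.div_add_mod]
  rw [digitWeight, hxf _ hlt]
  simp only [f, hdiv, hu', i.2, u.2, and_self, dite_true, Fin.eta, Nat.mod_eq_of_lt (hr i u hu)]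

theorem exists_isChainCover_block_iff (hk : 0 < k) (hc : c ≤ k) {B : ℕ} (hB : k ^ (k * k) ≤ B)
    {K : Set (Fin n)} {j : ℕ} :
    (∃ w : Fin c → Fin n → ℕ, IsChainCover G K (block G k j) w) ↔
      ∃ x < B, IsChainCover G K (block G k j) fun (i : Fin c) u => digitWeight k x i u := by
  refine ⟨fun ⟨w, hw⟩ => ?_, fun ⟨_, _, hx⟩ => ⟨_, hx⟩⟩
  obtain ⟨r, hr, hrlt⟩ := hw.exists_rank (Set.toFinite _)
  obtain ⟨x, hx, hxr⟩ :=
    exists_digitWeight_eq hk hc fun i u hu => (hrlt i u hu).trans_le (ncard_block_le hk j)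
  exact ⟨x, hx.trans_le hB, hr.of_le_imp_le fun i u hu t ht h => by
    rwa [hxr i u hu, hxr i t ht] at h⟩

end Digits

section BlockSize

/-- The largest `k` for which all `k ^ (k * k)` families of `k` weights smaller than `k` on a block
of `k` vertices can be tried in `B` rounds. -/
def blockSize (B : ℕ) : ℕ :=
  Nat.findGreatest (fun k => k ^ (k * k) ≤ B) B

variable {B : ℕ}

theorem blockSize_pos (hB : 0 < B) : 0 < blockSize B :=
  Nat.le_findGreatest hB (by simpa [Nat.one_le_iff_ne_zero] using hB.ne')

theorem pow_blockSize_le (hB : 0 < B) : blockSize B ^ (blockSize B * blockSize B) ≤ B :=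
  Nat.findGreatest_spec (P := fun k => k ^ (k * k) ≤ B) hB <| by
    simpa [Nat.one_le_iff_ne_zero] using hB.ne'

theorem le_blockSize {k : ℕ} (hk : 0 < k) (h : k ^ (k * k) ≤ B) : k ≤ blockSize B :=
  Nat.le_findGreatest ((Nat.le_self_pow (Nat.mul_pos hk hk).ne' k).trans h) h

theorem lt_succ_blockSize_pow :
    B < (blockSize B + 1) ^ ((blockSize B + 1) * (blockSize B + 1)) := by
  by_contra! h
  exact (le_blockSize (Nat.succ_pos _) h).not_gt (Nat.lt_succ_self _)

end BlockSize

section Growth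

open Filter

theorem le_sq_mul_log_div {β L : ℝ} (hβ : 0 < β) (hL : 0 < L) (hlog : 4 ≤ Real.log (L / β))
    (hβL : 4 * Real.log β ≤ Real.log L) (hlogL : 25 * Real.log (L / β) ≤ L) {k : ℝ} (hk : 0 ≤ k)
    (h : L < (k + 1) ^ 2 * Real.log (k + 1)) : L ≤ k ^ 2 * Real.log (L / β) := by
  by_contra! hlt
  have hdiv := Real.log_div hL.ne' hβ.ne'
  set ℓ := Real.log (L / β)
  -- `(k + 1) ^ 2 ≤ 1.2 * k ^ 2 + 6` by AM-GM, and `6 * ℓ ≤ 0.24 * L`.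
  have hsq : (k + 1) ^ 2 * ℓ ≤ 1.44 * L := by
    nlinarith [mul_nonneg (sq_nonneg (k - 5)) (by linarith : 0 ≤ ℓ)]
  have hsqL : (k + 1) ^ 2 ≤ L := by nlinarith [sq_nonneg (k + 1)]
  have hlogk : 2 * Real.log (k + 1) ≤ Real.log L := by
    have := Real.log_le_log (by positivity) hsqL
    rwa [Real.log_pow] at this
  have hlogkℓ : Real.log (k + 1) ≤ 2 / 3 * ℓ := by linarith
  have : (k + 1) ^ 2 * Real.log (k + 1) ≤ (k + 1) ^ 2 * (2 / 3 * ℓ) := by gcongr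
  linarith

theorem eventually_mul_log_div_le {β : ℝ} (hβ : 0 < β) (C : ℝ) :
    ∀ᶠ L in atTop, C * Real.log (L / β) ≤ L := by
  have : (fun L => C * Real.log (L / β)) =o[atTop] fun L => L / β :=
    (Real.isLittleO_log_id_atTop.comp_tendsto (tendsto_id.atTop_div_const hβ)).const_mul_left C
  filter_upwards [this.bound hβ, eventually_gt_atTop 0] with L hL hL0
  calc C * Real.log (L / β) ≤ β * ‖L / β‖ := (le_abs_self _).trans hL
    _ = L := by rw [Real.norm_of_nonneg (by positivity), mul_div_cancel₀ _ hβ.ne']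

theorem eventually_le_sq_mul_log_div {β : ℝ} (hβ : 0 < β) :
    ∀ᶠ L in atTop, ∀ k : ℝ, 0 ≤ k → L < (k + 1) ^ 2 * Real.log (k + 1) →
      L ≤ k ^ 2 * Real.log (L / β) := by
  have hlog : Tendsto (fun L => Real.log (L / β)) atTop atTop :=
    Real.tendsto_log_atTop.comp (tendsto_id.atTop_div_const hβ)
  filter_upwards [eventually_gt_atTop 0, hlog.eventually_ge_atTop 4,
    Real.tendsto_log_atTop.eventually_ge_atTop (4 * Real.log β), eventually_mul_log_div_le hβ 25]
    with L hL hL4 hβL hlogL k hk h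
  exact le_sq_mul_log_div hβ hL hL4 hβL hlogL hk h

theorem div_le_mul_sqrt_logb_div {b x k : ℝ} (hb : 1 < b) (hx : 1 < x) (hk : 0 < k)
    (h : Real.log x ≤ k ^ 2 * Real.log (Real.log x / Real.log b)) :
    x / k ≤ x * √(Real.logb b (Real.logb b x)) / √(Real.logb b x) := by
  have hβ : 0 < Real.log b := Real.log_pos hb
  have hL : 0 < Real.log x := Real.log_pos hx
  have hlogb : 0 < Real.logb b x := Real.logb_pos hb hx
  rw [mul_div_assoc, div_eq_mul_one_div, ← Real.sqrt_div' _ hlogb.le]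
  refine mul_le_mul_of_nonneg_left (Real.le_sqrt_of_sq_le ?_) (zero_lt_one.trans hx).le
  rw [Real.logb, Real.logb, div_div_div_cancel_right₀ hβ.ne', div_pow, one_pow,
    div_le_div_iff₀ (by positivity) hL]
  linarith

theorem eventually_div_le {b : ℝ} (hb : 1 < b) : ∀ᶠ n : ℕ in atTop, ∀ k : ℕ, 0 < k →
    n < (k + 1) ^ ((k + 1) * (k + 1)) →
    (n : ℝ) / k ≤ n * √(Real.logb b (Real.logb b n)) / √(Real.logb b n) := by
  have hlog : Tendsto (fun n : ℕ => Real.log n) atTop atTop :=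
    Real.tendsto_log_atTop.comp tendsto_natCast_atTop_atTop
  filter_upwards [eventually_gt_atTop 1,
    hlog.eventually (eventually_le_sq_mul_log_div (Real.log_pos hb))] with n hn hbound k hk hnk
  refine div_le_mul_sqrt_logb_div hb (Nat.one_lt_cast.2 hn) (Nat.cast_pos.2 hk)
    (hbound k (Nat.cast_nonneg k) ?_)
  have hlt : (n : ℝ) < ((k : ℝ) + 1) ^ ((k + 1) * (k + 1)) := mod_cast hnk
  calc Real.log n < Real.log (((k : ℝ) + 1) ^ ((k + 1) * (k + 1))) :=
        Real.log_lt_log (mod_cast zero_lt_one.trans hn) hlt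
    _ = ((k : ℝ) + 1) ^ 2 * Real.log (k + 1) := by rw [Real.log_pow]; push_cast; ring

theorem exists_div_blockSize_add_one_le {b : ℝ} (hb : 1 < b) : ∃ c > 0, ∀ n : ℕ, b < n →
    n / blockSize (n + c) + 1 ≤
      2 * ⌈(n : ℝ) * √(Real.logb b (Real.logb b n)) / √(Real.logb b n)⌉₊ := by
  obtain ⟨N, hN⟩ := eventually_atTop.1 (eventually_div_le hb)
  refine ⟨(N + 1) ^ ((N + 1) * (N + 1)), by positivity, fun n hbn => ?_⟩
  set B := n + (N + 1) ^ ((N + 1) * (N + 1))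
  have hn : (1 : ℝ) < n := hb.trans hbn
  have one_le_ceil : 1 ≤ ⌈(n : ℝ) * √(Real.logb b (Real.logb b n)) / √(Real.logb b n)⌉₊ := by
    have hlog : 1 < Real.logb b n := by
      rwa [Real.lt_logb_iff_rpow_lt hb (by linarith), Real.rpow_one]
    have := Real.logb_pos hb hlog
    exact Nat.ceil_pos.2 (by positivity)
  rcases lt_or_ge n (blockSize B) with hlt | hle
  · rw [Nat.div_eq_of_lt hlt]
    omega
  · have hNn : N ≤ n :=
      (Nat.le_succ N).trans ((le_blockSize N.succ_pos (Nat.le_add_left _ n)).trans hle)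
    have hB : 0 < B := Nat.lt_add_left n (by positivity)
    have hdiv : n / blockSize B ≤
        ⌈(n : ℝ) * √(Real.logb b (Real.logb b n)) / √(Real.logb b n)⌉₊ := by
      refine (Nat.cast_le (α := ℝ)).1 ((Nat.cast_div_le).trans ((hN n hNn _ (blockSize_pos hB)
        ((Nat.le_add_right n _).trans_lt lt_succ_blockSize_pow)).trans (Nat.le_ceil _)))
    omega

end Growth

end SplitGraph

namespace Ram

section HaltsWithin

/-- Total correctness with a time bound: started in `σ`, the program `P` halts within `T` steps in a
state that satisfies `Q`. -/
def HaltsWithin (P : Prog) (σ : State) (T : ℕ) (Q : State → Prop) : Prop :=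
  ∃ τ S, Exec P σ τ S ∧ S ≤ T ∧ Q τ

variable {P P' : Prog} {σ : State} {S T : ℕ} {Q Q' R : State → Prop} {e : Expr}

theorem HaltsWithin.mono (h : HaltsWithin P σ S Q) (hST : S ≤ T) (hQ : ∀ τ, Q τ → Q' τ) :
    HaltsWithin P σ T Q' :=
  let ⟨τ, U, hexec, hU, hτ⟩ := h
  ⟨τ, U, hexec, hU.trans hST, hQ τ hτ⟩

theorem haltsWithin_assign {x : ℕ} (h : Q (σ.setReg x (e.eval σ))) :
    HaltsWithin (.assign x e) σ 1 Q :=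
  ⟨_, _, .assign x e σ, le_rfl, h⟩

theorem HaltsWithin.seq (h : HaltsWithin P σ S R) (h' : ∀ τ, R τ → HaltsWithin P' τ T Q) :
    HaltsWithin (.seq P P') σ (S + T) Q :=
  let ⟨τ, _, hexec, hS, hτ⟩ := h
  let ⟨υ, _, hexec', hT, hυ⟩ := h' τ hτ
  ⟨υ, _, .seq hexec hexec', Nat.add_le_add hS hT, hυ⟩

theorem haltsWithin_cond (htrue : e.eval σ ≠ 0 → HaltsWithin P σ T Q)
    (hfalse : e.eval σ = 0 → HaltsWithin P' σ T Q) : HaltsWithin (.cond e P P') σ (T + 1) Q := by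
  by_cases he : e.eval σ = 0
  · obtain ⟨τ, S, hexec, hS, hτ⟩ := hfalse he
    exact ⟨τ, S + 1, .cond_false he hexec, Nat.succ_le_succ hS, hτ⟩
  · obtain ⟨τ, S, hexec, hS, hτ⟩ := htrue he
    exact ⟨τ, S + 1, .cond_true he hexec, Nat.succ_le_succ hS, hτ⟩

theorem haltsWithin_loop {I : ℕ → State → Prop} {N : ℕ}
    (htest : ∀ j ≤ N, ∀ τ, I j τ → e.eval τ = N - j)
    (hbody : ∀ j < N, ∀ τ, I j τ → HaltsWithin P τ T (I (j + 1))) (h0 : I 0 σ) :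
    HaltsWithin (.loop e P) σ (N * (T + 1) + 1) (I N) := by
  suffices ∀ d ≤ N, ∀ τ, I (N - d) τ → HaltsWithin (.loop e P) τ (d * (T + 1) + 1) (I N) from
    this N le_rfl σ (by rwa [Nat.sub_self])
  intro d
  induction d with
  | zero => exact fun _ τ hτ => ⟨τ, 1, .loop_done (by simp [htest N le_rfl τ hτ]), by simp, hτ⟩
  | succ d ih =>
    intro hd τ hτ
    have hne : e.eval τ ≠ 0 := by rw [htest _ (Nat.sub_le _ _) τ hτ]; omega
    obtain ⟨υ, S, hexec, hS, hυ⟩ := hbody _ (by omega) τ hτ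
    rw [show N - (d + 1) + 1 = N - d by omega] at hυ
    obtain ⟨ρ, S', hexec', hS', hρ⟩ := ih (by omega) υ hυ
    exact ⟨ρ, S + S' + 1, .loop_again hne hexec hexec', by rw [Nat.succ_mul]; omega, hρ⟩

end HaltsWithin

section Agree

/-- The state `τ` differs from `σ` at most in the registers from `m` on. -/
structure Agree (m : ℕ) (σ τ : State) : Prop where
  reg_eq : ∀ r < m, τ.reg r = σ.reg r
  arr_eq : τ.arr = σ.arr

variable {m m' x c : ℕ} {σ τ υ : State}

theorem Agree.refl (m : ℕ) (σ : State) : Agree m σ σ :=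
  ⟨fun _ _ => rfl, rfl⟩

theorem Agree.trans (h : Agree m σ τ) (h' : Agree m τ υ) : Agree m σ υ :=
  ⟨fun r hr => (h'.reg_eq r hr).trans (h.reg_eq r hr), h'.arr_eq.trans h.arr_eq⟩

theorem Agree.mono (h : Agree m' σ τ) (hm : m ≤ m') : Agree m σ τ :=
  ⟨fun r hr => h.reg_eq r (hr.trans_le hm), h.arr_eq⟩

theorem Agree.setReg (h : Agree m σ τ) (hx : m ≤ x) (c : ℕ) : Agree m σ (τ.setReg x c) :=
  ⟨fun r hr => (Function.update_of_ne (hr.trans_le hx).ne _ _).trans (h.reg_eq r hr), h.arr_eq⟩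

theorem setReg_reg_self : (σ.setReg x c).reg x = c :=
  Function.update_self _ _ _

theorem setReg_reg_of_ne {y : ℕ} (h : y ≠ x) : (σ.setReg x c).reg y = σ.reg y :=
  Function.update_of_ne h _ _

end Agree

section Represents

/-- An input graph together with a number `bound > n`, in terms of which running times are
measured: every loop of the algorithm makes at most `bound` rounds. -/
structure Input where
  n : ℕ
  graph : SimpleGraph (Fin n)
  bound : ℕ
  n_lt_bound : n < bound

/-- The elements of `Γ` stand for an input together with the values of `size Γ` variables. -/
class Context (Γ : Type) where
  size : ℕ
  value : Γ → ℕ → ℕ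
  input : Γ → Input

open Context (input)

/-- A context `Δ` over a context `Γ` with one more variable, whose value is `x`. -/
abbrev Context.extend {Γ Δ : Type} [Context Γ] (π : Δ → Γ) (x : Δ → ℕ) : Context Δ where
  size := size Γ + 1
  value δ := Function.update (value (π δ)) (size Γ) (x δ)
  input δ := input (π δ)

instance : Context Input where
  size := 0
  value _ _ := 0
  input := id

variable {Γ : Type} [Context Γ]

instance : Context (Γ × ℕ) :=
  .extend Prod.fst Prod.snd

instance {N : Γ → ℕ} : Context ((γ : Γ) × Fin (N γ)) :=
  .extend Sigma.fst fun δ => δ.2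

/-- The state `σ` holds the element `γ` of a context: the input graph in array `0`, with the
number of vertices in register `0`, the bound in register `1`, and the `i`-th variable in register
`l i`. -/
structure Represents (l : ℕ → ℕ) (σ : State) (γ : Γ) : Prop where
  n_eq : σ.reg 0 = (input γ).n
  bound_eq : σ.reg 1 = (input γ).bound
  arr_eq : σ.arr 0 = (graphInput (input γ).graph).arr 0
  value_eq : ∀ i < Context.size Γ, σ.reg (l i) = Context.value γ i

variable {l : ℕ → ℕ} {m : ℕ} {σ τ : State} {γ : Γ}

theorem Represents.of_agree (h : Represents l σ γ) (hm : 2 ≤ m)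
    (hl : ∀ i < Context.size Γ, l i < m) (hστ : Agree m σ τ) : Represents l τ γ where
  n_eq := (hστ.reg_eq 0 (by omega)).trans h.n_eq
  bound_eq := (hστ.reg_eq 1 (by omega)).trans h.bound_eq
  arr_eq := (congrFun hστ.arr_eq 0).trans h.arr_eq
  value_eq i hi := (hστ.reg_eq _ (hl i hi)).trans (h.value_eq i hi)

variable {Δ : Type} {π : Δ → Γ} {x : Δ → ℕ} {δ : Δ}

theorem Represents.extend (h : Represents l σ (π δ)) {r : ℕ} (hr : σ.reg r = x δ) :
    @Represents Δ (.extend π x) (Function.update l (Context.size Γ) r) σ δ :=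
  let : Context Δ := .extend π x
  { n_eq := h.n_eq
    bound_eq := h.bound_eq
    arr_eq := h.arr_eq
    value_eq := fun i hi => by
      rcases (Nat.lt_succ_iff.1 hi).lt_or_eq with hi | rfl
      · simpa [Context.value, hi.ne] using h.value_eq i hi
      · simpa [Context.value] using hr }

theorem Represents.of_extend (h : @Represents Δ (.extend π x) l σ δ) : Represents l σ (π δ) :=
  let : Context Δ := .extend π x
  { n_eq := h.n_eq
    bound_eq := h.bound_eq
    arr_eq := h.arr_eq
    value_eq := fun i hi => by
      simpa [Context.value, hi.ne] using h.value_eq i (Nat.lt_succ_of_lt hi) }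

theorem Represents.reg_extend (h : @Represents Δ (.extend π x) l σ δ) :
    σ.reg (l (Context.size Γ)) = x δ := by
  let : Context Δ := .extend π x
  simpa [Context.value] using h.value_eq _ (Nat.lt_succ_self _)

end Represents

open Context (input)

section Computes

variable {Γ : Type} [Context Γ] {f g : Γ → ℕ}

/-- The program `P` evaluates `f` : it writes the value into register `m`, uses no registers below
`m` for its own purposes, and takes at most `p (bound)` steps. -/
def Evaluates (P : Prog) (p : Polynomial ℕ) (l : ℕ → ℕ) (m : ℕ) (f : Γ → ℕ) : Prop :=
  ∀ σ γ, Represents l σ γ → HaltsWithin P σ (p.eval (input γ).bound) fun τ =>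
    τ.reg m = f γ ∧ Agree m σ τ

theorem Evaluates.seq {P Q : Prog} {p q : Polynomial ℕ} {l : ℕ → ℕ} {m : ℕ}
    (hP : Evaluates P p l m f) (hQ : Evaluates Q q l (m + 1) g) (hm : 2 ≤ m)
    (hl : ∀ i < Context.size Γ, l i < m) {σ : State} {γ : Γ} (h : Represents l σ γ) :
    HaltsWithin (.seq P Q) σ (p.eval (input γ).bound + q.eval (input γ).bound) fun τ =>
      τ.reg m = f γ ∧ τ.reg (m + 1) = g γ ∧ Agree m σ τ :=
  (hP σ γ h).seq fun τ ⟨hτ, hστ⟩ => (hQ τ γ (h.of_agree hm hl hστ)).mono le_rfl fun _ ⟨hυ, hτυ⟩ =>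
    ⟨(hτυ.reg_eq m m.lt_succ_self).trans hτ, hυ, hστ.trans (hτυ.mono m.le_succ)⟩

/-- The function `f` is computable in polynomial time. The program may depend on the places `l` of
the variables and on the first free register `m`, so that programs can be nested. -/
def Computes (f : Γ → ℕ) : Prop :=
  ∃ p : Polynomial ℕ, ∀ l m, 2 ≤ m → (∀ i < Context.size Γ, l i < m) →
    ∃ P, Evaluates P p l m f

open Classical in
/-- The predicate `p` is decidable in polynomial time. -/
def Decides (p : Γ → Prop) : Prop :=
  Computes fun γ => if p γ then 1 else 0

namespace Computes

theorem congr (hf : Computes f) (h : ∀ γ, g γ = f γ) : Computes g :=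
  funext h ▸ hf

theorem of_expr (e : (ℕ → ℕ) → Expr)
    (he : ∀ l σ γ, Represents l σ γ → (e l).eval σ = f γ) : Computes f :=
  ⟨1, fun l m _ _ => ⟨.assign m (e l), fun σ γ h => by
    rw [Polynomial.eval_one]
    refine haltsWithin_assign ⟨?_, (Agree.refl m σ).setReg le_rfl _⟩
    rw [setReg_reg_self, he l σ γ h]⟩⟩

theorem const (c : ℕ) : Computes fun _ : Γ => c :=
  .of_expr (fun _ => .const c) fun _ _ _ _ => rfl

theorem n : Computes fun γ : Γ => (input γ).n :=
  .of_expr (fun _ => .reg 0) fun _ _ _ h => h.n_eq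

theorem bound : Computes fun γ : Γ => (input γ).bound :=
  .of_expr (fun _ => .reg 1) fun _ _ _ h => h.bound_eq

theorem snd : Computes fun γ : Γ × ℕ => γ.2 :=
  .of_expr (fun l => .reg (l (Context.size Γ))) fun _ _ _ h => h.reg_extend

theorem var {N : Γ → ℕ} : Computes fun δ : (γ : Γ) × Fin (N γ) => (δ.2 : ℕ) :=
  .of_expr (fun l => .reg (l (Context.size Γ))) fun _ _ _ h => h.reg_extend

theorem comp_extend (hf : Computes f) {Δ : Type} (π : Δ → Γ) (x : Δ → ℕ) :
    @Computes Δ (.extend π x) fun δ => f (π δ) := by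
  obtain ⟨p, hp⟩ := hf
  refine ⟨p, fun l m hm hl => ?_⟩
  obtain ⟨P, hP⟩ := hp l m hm fun i hi => hl i (Nat.lt_succ_of_lt hi)
  exact ⟨P, fun σ δ h => hP σ (π δ) h.of_extend⟩

theorem fst (hf : Computes f) : Computes fun γ : Γ × ℕ => f γ.1 :=
  hf.comp_extend Prod.fst Prod.snd

theorem weaken (hf : Computes f) {N : Γ → ℕ} : Computes fun δ : (γ : Γ) × Fin (N γ) => f δ.1 :=
  hf.comp_extend (Δ := (γ : Γ) × Fin (N γ)) Sigma.fst fun δ => δ.2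

theorem map₂ (hf : Computes f) (hg : Computes g) {F : ℕ → ℕ → ℕ} (e : Expr → Expr → Expr)
    (he : ∀ σ a b, (e a b).eval σ = F (a.eval σ) (b.eval σ)) : Computes fun γ => F (f γ) (g γ) := by
  obtain ⟨p, hp⟩ := hf
  obtain ⟨q, hq⟩ := hg
  refine ⟨p + q + 1, fun l m hm hl => ?_⟩
  obtain ⟨P, hP⟩ := hp l m hm hl
  obtain ⟨Q, hQ⟩ := hq l (m + 1) (by omega) fun i hi => (hl i hi).trans m.lt_succ_self
  refine ⟨.seq (.seq P Q) (.assign m (e (.reg m) (.reg (m + 1)))), fun σ γ h => ?_⟩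
  simp only [Polynomial.eval_add, Polynomial.eval_one]
  refine (hP.seq hQ hm hl h).seq fun τ ⟨hf, hg, hστ⟩ =>
    haltsWithin_assign ⟨?_, hστ.setReg le_rfl _⟩
  rw [setReg_reg_self, he, Expr.eval, Expr.eval, hf, hg]

theorem add (hf : Computes f) (hg : Computes g) : Computes fun γ => f γ + g γ :=
  hf.map₂ hg .add fun _ _ _ => rfl

theorem sub (hf : Computes f) (hg : Computes g) : Computes fun γ => f γ - g γ :=
  hf.map₂ hg .sub fun _ _ _ => rfl

theorem matrixEntry (hf : Computes f) :
    Computes fun γ => (graphInput (input γ).graph).arr 0 (f γ) := by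
  obtain ⟨p, hp⟩ := hf
  refine ⟨p + 1, fun l m hm hl => ?_⟩
  obtain ⟨P, hP⟩ := hp l m hm hl
  refine ⟨.seq P (.assign m (.read 0 (.reg m))), fun σ γ h => ?_⟩
  simp only [Polynomial.eval_add, Polynomial.eval_one]
  refine (hP σ γ h).seq fun τ ⟨hτ, hστ⟩ => haltsWithin_assign ⟨?_, hστ.setReg le_rfl _⟩
  rw [setReg_reg_self, Expr.eval, Expr.eval, hτ, (h.of_agree hm hl hστ).arr_eq]

theorem ite {p : Γ → Prop} [DecidablePred p] (hp : Decides p) (hf : Computes f)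
    (hg : Computes g) : Computes fun γ => if p γ then f γ else g γ := by
  obtain ⟨o, ho⟩ := hp
  obtain ⟨p', hp⟩ := hf
  obtain ⟨q, hq⟩ := hg
  refine ⟨o + (p' + q + 1), fun l m hm hl => ?_⟩
  obtain ⟨O, hO⟩ := ho l m hm hl
  obtain ⟨P, hP⟩ := hp l m hm hl
  obtain ⟨Q, hQ⟩ := hq l m hm hl
  refine ⟨.seq O (.cond (.reg m) P Q), fun σ γ h => ?_⟩
  simp only [Polynomial.eval_add, Polynomial.eval_one]
  refine (hO σ γ h).seq fun τ ⟨hτ, hστ⟩ => haltsWithin_cond ?_ ?_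
  · intro htest
    have hpγ : p γ := by by_contra hpγ; simp [Expr.eval, hτ, hpγ] at htest
    refine (hP τ γ (h.of_agree hm hl hστ)).mono (Nat.le_add_right _ _) fun υ ⟨hυ, hτυ⟩ => ?_
    exact ⟨by rw [hυ, if_pos hpγ], hστ.trans hτυ⟩
  · intro htest
    have hpγ : ¬p γ := by intro hpγ; simp [Expr.eval, hτ, hpγ] at htest
    refine (hQ τ γ (h.of_agree hm hl hστ)).mono (Nat.le_add_left _ _) fun υ ⟨hυ, hτυ⟩ => ?_
    exact ⟨by rw [hυ, if_neg hpγ], hστ.trans hτυ⟩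

/-- The situation during the iteration with values `a 0, a 1, …, a N` : these appear in
register `m + 1`, while register `m` holds `N` and register `m + 2` counts the rounds. -/
structure LoopInvariant (m : ℕ) (σ : State) (N : ℕ) (a : ℕ → ℕ) (j : ℕ) (τ : State) : Prop where
  rounds : τ.reg m = N
  acc : τ.reg (m + 1) = a j
  counter : τ.reg (m + 2) = j
  agree : Agree m σ τ

/-- One round of the iteration, where `R` computes the next value into register `m + 3`. -/
def iterateBody (R : Prog) (m : ℕ) : Prog :=
  .seq (.seq R (.assign (m + 1) (.reg (m + 3)))) (.assign (m + 2) (.add (.reg (m + 2)) (.const 1)))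

/-- The places of the variables during the iteration. -/
def iterateLayout (Γ : Type) [Context Γ] (l : ℕ → ℕ) (m : ℕ) : ℕ → ℕ :=
  Function.update (Function.update l (Context.size Γ) (m + 2)) (Context.size Γ + 1) (m + 1)

theorem iterateLayout_lt {l : ℕ → ℕ} {m : ℕ} (hl : ∀ i < Context.size Γ, l i < m) :
    ∀ i < Context.size Γ + 2, iterateLayout Γ l m i < m + 3 := by
  intro i hi
  simp only [iterateLayout, Function.update_apply]
  split_ifs
  exacts [by omega, by omega, (hl i (by omega)).trans (by omega)]

variable {N : Γ → ℕ} {s : ((γ : Γ) × Fin (N γ)) × ℕ → ℕ} {a : Γ → ℕ → ℕ}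

theorem haltsWithin_iterateBody {l : ℕ → ℕ} {m : ℕ}
    (hrec : ∀ γ (i : Fin (N γ)), a γ (i + 1) = s (⟨γ, i⟩, a γ i)) (hm : 2 ≤ m)
    (hl : ∀ i < Context.size Γ, l i < m) {R : Prog} {r : Polynomial ℕ}
    (hR : Evaluates R r (iterateLayout Γ l m) (m + 3) s) {σ : State} {γ : Γ}
    (h : Represents l σ γ) {j : ℕ} (hj : j < N γ) {τ : State}
    (hτ : LoopInvariant m σ (N γ) (a γ) j τ) :
    HaltsWithin (iterateBody R m) τ (r.eval (input γ).bound + 1 + 1)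
      (LoopInvariant m σ (N γ) (a γ) (j + 1)) := by
  let δ : (γ : Γ) × Fin (N γ) := ⟨γ, ⟨j, hj⟩⟩
  have hδ : Represents (Function.update l (Context.size Γ) (m + 2)) τ δ :=
    (h.of_agree hm hl hτ.agree).extend hτ.counter
  have hδa : Represents (iterateLayout Γ l m) τ (δ, a γ j) :=
    Represents.extend (π := Prod.fst) (x := Prod.snd) (δ := (δ, a γ j)) hδ hτ.acc
  refine ((hR τ (δ, a γ j) hδa).seq fun υ ⟨hυ, hτυ⟩ => haltsWithin_assign
    (Q := fun υ => υ.reg (m + 1) = a γ (j + 1) ∧ Agree (m + 1) τ υ ∧ υ.reg (m + 2) = j) ?_).seq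
    fun υ ⟨hacc, hτυ, hcounter⟩ => haltsWithin_assign ?_
  · refine ⟨?_, (hτυ.mono (by omega)).setReg le_rfl _, ?_⟩
    · rw [setReg_reg_self, Expr.eval, hυ, hrec γ ⟨j, hj⟩]
    · rw [setReg_reg_of_ne (by omega), hτυ.reg_eq _ (by omega), hτ.counter]
  · have hagree := hτυ.setReg (m + 1).le_succ (Expr.eval υ (.add (.reg (m + 2)) (.const 1)))
    exact
      { rounds := (hagree.reg_eq m m.lt_succ_self).trans hτ.rounds
        acc := by rw [setReg_reg_of_ne (by omega), hacc]
        counter := by rw [setReg_reg_self, Expr.eval, Expr.eval, Expr.eval, hcounter]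
        agree := hτ.agree.trans (hagree.mono m.le_succ) }

theorem iterate (hN : Computes N) (hle : ∀ γ, N γ ≤ (input γ).bound)
    (h0 : Computes fun γ => a γ 0) (hs : Computes s)
    (hrec : ∀ γ (i : Fin (N γ)), a γ (i + 1) = s (⟨γ, i⟩, a γ i)) :
    Computes fun γ => a γ (N γ) := by
  obtain ⟨p, hp⟩ := hN
  obtain ⟨q, hq⟩ := h0
  obtain ⟨r, hr⟩ := hs
  refine ⟨p + q + 1 + (.X * (r + 1 + 1 + 1) + 1) + 1, fun l m hm hl => ?_⟩
  obtain ⟨P, hP⟩ := hp l m hm hl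
  obtain ⟨Q, hQ⟩ := hq l (m + 1) (by omega) fun i hi => (hl i hi).trans m.lt_succ_self
  obtain ⟨R, hR⟩ := hr (iterateLayout Γ l m) (m + 3) (by omega) (iterateLayout_lt hl)
  let test : Expr := .sub (.reg m) (.reg (m + 2))
  refine ⟨.seq (.seq (.seq (.seq P Q) (.assign (m + 2) (.const 0)))
    (.loop test (iterateBody R m))) (.assign m (.reg (m + 1))), fun σ γ h => ?_⟩
  have hinit := (hP.seq hQ hm hl h).seq fun τ ⟨hN, ha, hστ⟩ =>
    haltsWithin_assign (x := m + 2) (e := .const 0) (Q := LoopInvariant m σ (N γ) (a γ) 0)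
      { rounds := by rw [setReg_reg_of_ne (by omega), hN]
        acc := by rw [setReg_reg_of_ne (by omega), ha]
        counter := setReg_reg_self
        agree := hστ.setReg (by omega) _ }
  have hloop := hinit.seq fun τ hτ => haltsWithin_loop (e := test)
    (fun j _ υ hυ => by rw [Expr.eval, Expr.eval, Expr.eval, hυ.rounds, hυ.counter])
    (fun j hj υ hυ => haltsWithin_iterateBody hrec hm hl hR h hj hυ) hτ
  refine (hloop.seq fun τ hτ => haltsWithin_assign ⟨?_, hτ.agree.setReg le_rfl _⟩).mono ?_
    fun _ => id
  · have := Nat.mul_le_mul_right (r.eval (input γ).bound + 1 + 1 + 1) (hle γ)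
    simp only [Polynomial.eval_add, Polynomial.eval_one, Polynomial.eval_mul, Polynomial.eval_X]
    omega
  · rw [setReg_reg_self, Expr.eval, hτ.acc]

end Computes

end Computes

namespace Decides

variable {Γ : Type} [Context Γ] {f g : Γ → ℕ} {p q : Γ → Prop}

theorem congr (hp : Decides p) (h : ∀ γ, q γ ↔ p γ) : Decides q :=
  funext (fun γ => propext (h γ)) ▸ hp

theorem fst (hp : Decides p) : Decides fun γ : Γ × ℕ => p γ.1 :=
  Computes.fst hp

theorem ne_zero (hf : Computes f) : Decides fun γ => f γ ≠ 0 :=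
  Computes.congr (.sub (.const 1) (.sub (.const 1) hf)) fun γ => by split_ifs <;> omega

theorem not (hp : Decides p) : Decides fun γ => ¬p γ :=
  congr (ne_zero (.sub (.const 1) hp)) fun γ => by
    by_cases hγ : p γ <;> simp [hγ]

theorem and (hp : Decides p) (hq : Decides q) : Decides fun γ => p γ ∧ q γ := by
  classical
  exact Computes.congr (.ite hp hq (.const 0)) fun γ => by
    by_cases hpγ : p γ <;> simp only [hpγ, true_and, false_and, if_true, if_false]

theorem imp (hp : Decides p) (hq : Decides q) : Decides fun γ => p γ → q γ :=
  (hp.and hq.not).not.congr fun γ => by simp only [not_and, not_not]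

theorem lt (hf : Computes f) (hg : Computes g) : Decides fun γ => f γ < g γ :=
  (ne_zero (hg.sub hf)).congr fun _ => Nat.sub_ne_zero_iff_lt.symm

theorem le (hf : Computes f) (hg : Computes g) : Decides fun γ => f γ ≤ g γ :=
  (lt hg hf).not.congr fun _ => not_lt.symm

theorem eq (hf : Computes f) (hg : Computes g) : Decides fun γ => f γ = g γ :=
  ((le hf hg).and (le hg hf)).congr fun _ => le_antisymm_iff

end Decides

section Iterations

variable {Γ : Type} [Context Γ] {f g h N : Γ → ℕ}

namespace Computes

theorem sum {f : (γ : Γ) × Fin (N γ) → ℕ} (hN : Computes N) (hle : ∀ γ, N γ ≤ (input γ).bound)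
    (hf : Computes f) : Computes fun γ => ∑ i : Fin (N γ), f ⟨γ, i⟩ := by
  have := iterate (s := fun x => x.2 + f x.1)
    (a := fun γ j => ∑ i ∈ Finset.range j, if h : i < N γ then f ⟨γ, i, h⟩ else 0)
    hN hle (const 0) (snd.add hf.fst) fun γ i => by
      rw [Finset.sum_range_succ, dif_pos i.2]
  exact this.congr fun γ => Finset.sum_fin_eq_sum_range _

theorem mul (hf : Computes f) (hle : ∀ γ, f γ ≤ (input γ).bound) (hg : Computes g) :
    Computes fun γ => f γ * g γ :=
  (sum hf hle hg.weaken).congr fun γ => by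
    simp only [Finset.sum_const, Finset.card_univ, Fintype.card_fin, smul_eq_mul]

theorem mul_pow (hf : Computes f) (hfle : ∀ γ, f γ ≤ (input γ).bound) (hg : Computes g)
    (hgle : ∀ γ, g γ ≤ (input γ).bound) (hh : Computes h) : Computes fun γ => h γ * f γ ^ g γ :=
  iterate (a := fun γ j => h γ * f γ ^ j) hg hgle (hh.congr fun _ => by rw [pow_zero, mul_one])
    (mul hf.weaken.fst (fun δ => hfle δ.1.1) snd) fun _ _ => by ring

theorem pow_mul (hf : Computes f) (hfle : ∀ γ, f γ ≤ (input γ).bound) (hg : Computes g)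
    (hgle : ∀ γ, g γ ≤ (input γ).bound) (hh : Computes h) (hhle : ∀ γ, h γ ≤ (input γ).bound) :
    Computes fun γ => f γ ^ (g γ * h γ) :=
  iterate (a := fun γ j => f γ ^ (g γ * j)) hh hhle (const 1)
    (mul_pow hf.weaken.fst (fun δ => hfle δ.1.1) hg.weaken.fst (fun δ => hgle δ.1.1) snd)
    fun γ i => by rw [Nat.mul_succ, pow_add]

theorem findGreatest {p : Γ → ℕ → Prop} [∀ γ, DecidablePred (p γ)] (hN : Computes N)
    (hle : ∀ γ, N γ ≤ (input γ).bound)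
    (hp : Decides fun δ : (γ : Γ) × Fin (N γ) => p δ.1 (δ.2 + 1)) :
    Computes fun γ => Nat.findGreatest (p γ) (N γ) :=
  iterate (a := fun γ j => Nat.findGreatest (p γ) j) hN hle (const 0)
    (.ite hp.fst (var.add (const 1)).fst snd) fun _ i => Nat.findGreatest_succ i

theorem div (hf : Computes f) (hle : ∀ γ, f γ ≤ (input γ).bound) (hg : Computes g) :
    Computes fun γ => f γ / g γ := by
  refine (findGreatest (p := fun γ q => 0 < g γ ∧ q * g γ ≤ f γ) hf hle
    (.and (.lt (const 0) hg.weaken) (.le (mul (var.add (const 1)) (fun δ => ?_) hg.weaken)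
      hf.weaken))).congr fun γ => ?_
  · exact (Nat.succ_le_of_lt δ.2.2).trans (hle δ.1)
  · have hpos : f γ / g γ ≠ 0 → 0 < g γ := fun h =>
      Nat.pos_of_ne_zero fun hg => h (by rw [hg, Nat.div_zero])
    refine (Nat.findGreatest_eq_iff.2 ⟨Nat.div_le_self _ _, fun h =>
      ⟨hpos h, Nat.div_mul_le_self _ _⟩, fun q hq _ h => ?_⟩).symm
    exact hq.not_ge ((Nat.le_div_iff_mul_le h.1).2 h.2)

theorem mod (hf : Computes f) (hle : ∀ γ, f γ ≤ (input γ).bound) (hg : Computes g) :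
    Computes fun γ => f γ % g γ :=
  (hf.sub (mul (div hf hle hg) (fun γ => (Nat.div_le_self _ _).trans (hle γ)) hg)).congr
    fun γ => by rw [Nat.mod_eq_sub, mul_comm]

protected theorem sInf {S : Γ → Set ℕ} (hN : Computes N) (hle : ∀ γ, N γ ≤ (input γ).bound)
    (hS : Decides fun δ : (γ : Γ) × Fin (N γ) => (δ.2 : ℕ) ∈ S δ.1)
    (hne : ∀ γ, ∃ c ≤ N γ, c ∈ S γ) : Computes fun γ => sInf (S γ) := by
  classical
  refine (iterate (a := fun γ j => min j (InfSet.sInf (S γ))) hN hle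
    ((const 0).congr fun _ => Nat.zero_min _)
    (.ite ((Decides.eq snd var.fst).and hS.not.fst) (snd.add (const 1)) snd)
    fun γ i => ?_).congr fun γ => ?_
  · obtain ⟨c, -, hc⟩ := hne γ
    have hmem := Nat.sInf_mem ⟨c, hc⟩
    by_cases hi : (i : ℕ) ∈ S γ
    · have := Nat.sInf_le hi
      simp only [hi, not_true_eq_false, and_false, if_false]
      omega
    · have : (i : ℕ) ≠ InfSet.sInf (S γ) := fun h => hi (h ▸ hmem)
      simp only [hi, not_false_eq_true, and_true]
      split_ifs <;> omega
  · obtain ⟨c, hcN, hc⟩ := hne γ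
    exact (min_eq_right ((Nat.sInf_le hc).trans hcN)).symm

end Computes

variable {p : (γ : Γ) × Fin (N γ) → Prop}

theorem Decides.exists_fin (hN : Computes N) (hle : ∀ γ, N γ ≤ (input γ).bound)
    (hp : Decides p) : Decides fun γ => ∃ i : Fin (N γ), p ⟨γ, i⟩ :=
  (Decides.ne_zero (.sum hN hle hp)).congr fun γ => by simp

theorem Decides.forall_fin (hN : Computes N) (hle : ∀ γ, N γ ≤ (input γ).bound)
    (hp : Decides p) : Decides fun γ => ∀ i : Fin (N γ), p ⟨γ, i⟩ :=
  (Decides.exists_fin hN hle hp.not).not.congr fun γ => by simp only [not_exists, not_not]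

end Iterations

section Algorithm

open SplitGraph

variable {Γ : Type} [Context Γ]

theorem graphInput_arr_ne_zero_iff {n : ℕ} {G : SimpleGraph (Fin n)} {u v : Fin n} :
    (graphInput G).arr 0 (n * u + v) ≠ 0 ↔ G.Adj u v := by
  have exists_iff : (∃ u' v', G.Adj u' v' ∧ n * (u : ℕ) + v = n * u' + v') ↔ G.Adj u v := by
    refine ⟨fun ⟨u', v', hadj, h⟩ => ?_, fun hadj => ⟨u, v, hadj, rfl⟩⟩
    have : finProdFinEquiv (u, v) = finProdFinEquiv (u', v') :=
      Fin.ext (by simp only [finProdFinEquiv_apply_val, add_comm (v : ℕ), add_comm (v' : ℕ), h])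
    obtain ⟨rfl, rfl⟩ := Prod.mk_inj.1 (finProdFinEquiv.injective this)
    exact hadj
  simp [graphInput, exists_iff]

theorem val_le_bound {γ : Γ} (u : Fin (input γ).n) : (u : ℕ) ≤ (input γ).bound :=
  (u.2.trans (input γ).n_lt_bound).le

namespace Decides

theorem forall_vertex {p : (γ : Γ) × Fin (input γ).n → Prop} (hp : Decides p) :
    Decides fun γ => ∀ u : Fin (input γ).n, p ⟨γ, u⟩ :=
  hp.forall_fin .n fun γ => (input γ).n_lt_bound.le

variable {u v : ∀ γ : Γ, Fin (input γ).n}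

theorem adj (hu : Computes fun γ => (u γ : ℕ)) (hv : Computes fun γ => (v γ : ℕ)) :
    Decides fun γ => (input γ).graph.Adj (u γ) (v γ) :=
  (ne_zero (.matrixEntry (.add (.mul .n (fun γ => (input γ).n_lt_bound.le) hu) hv))).congr
    fun _ => graphInput_arr_ne_zero_iff.symm

theorem isSimplicial (hu : Computes fun γ => (u γ : ℕ)) :
    Decides fun γ => IsSimplicial (input γ).graph (u γ) := by
  have hx : Computes fun δ : (δ : (γ : Γ) × Fin (input γ).n) × Fin (input δ).n => (δ.1.2 : ℕ) :=
    Computes.var.weaken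
  refine (forall_vertex (forall_vertex ((adj (u := fun δ => u δ.1.1) (v := fun δ => δ.1.2)
    hu.weaken.weaken hx).imp ((adj (u := fun δ => u δ.1.1) (v := fun δ => δ.2)
    hu.weaken.weaken .var).imp ((eq hx .var).not.imp
    (adj (u := fun δ => δ.1.2) (v := fun δ => δ.2) hx .var)))))).congr fun γ => ?_
  simp only [IsSimplicial, SimpleGraph.IsClique, Set.Pairwise, SimpleGraph.mem_neighborSet,
    ne_eq, Fin.ext_iff]
  exact forall_congr' fun x => forall_comm

theorem mem_minSimplicial (hu : Computes fun γ => (u γ : ℕ)) :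
    Decides fun γ => u γ ∈ minSimplicial (input γ).graph :=
  (isSimplicial hu).and (forall_vertex ((lt .var hu.weaken).imp
    ((isSimplicial (u := fun δ => δ.2) .var).imp
      (adj (u := fun δ => u δ.1) (v := fun δ => δ.2) hu.weaken .var).not)))

variable {k j : Γ → ℕ}

theorem mem_block (hu : Computes fun γ => (u γ : ℕ)) (hk : Computes k) (hj : Computes j) :
    Decides fun γ => u γ ∈ block (input γ).graph (k γ) (j γ) :=
  (mem_minSimplicial hu).and (eq (.div hu (fun γ => val_le_bound (u γ)) hk) hj)

end Decides

theorem Computes.digitWeight {k x i u : Γ → ℕ} (hk : Computes k)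
    (hkle : ∀ γ, k γ ≤ (input γ).bound) (hx : Computes x) (hxle : ∀ γ, x γ ≤ (input γ).bound)
    (hi : Computes i) (hile : ∀ γ, i γ ≤ (input γ).bound) (hu : Computes u)
    (hule : ∀ γ, u γ ≤ (input γ).bound) :
    Computes fun γ => SplitGraph.digitWeight (k γ) (x γ) (i γ) (u γ) := by
  have hpow : Computes fun γ => k γ ^ (k γ * i γ + u γ % k γ) :=
    (mul_pow hk hkle (mod hu hule hk) (fun γ => (Nat.mod_le _ _).trans (hule γ))
      (pow_mul hk hkle hk hkle hi hile)).congr fun γ => pow_add _ _ _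
  exact mod (div hx hxle hpow) (fun γ => (Nat.div_le_self _ _).trans (hxle γ)) hk

variable {k j c x : Γ → ℕ}

theorem Decides.forall_digitWeight_le_imp_adj {i : Γ → ℕ} {u v : ∀ γ : Γ, Fin (input γ).n}
    (hk : Computes k) (hkle : ∀ γ, k γ ≤ (input γ).bound) (hj : Computes j) (hx : Computes x)
    (hxle : ∀ γ, x γ ≤ (input γ).bound) (hi : Computes i) (hile : ∀ γ, i γ ≤ (input γ).bound)
    (hu : Computes fun γ => (u γ : ℕ)) (hv : Computes fun γ => (v γ : ℕ)) :
    Decides fun γ => ∀ t ∈ block (input γ).graph (k γ) (j γ),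
      digitWeight (k γ) (x γ) (i γ) (u γ) ≤ digitWeight (k γ) (x γ) (i γ) t →
        (input γ).graph.Adj (v γ) t := by
  have hwu := Computes.digitWeight hk hkle hx hxle hi hile hu fun γ => val_le_bound (u γ)
  have hwt := Computes.digitWeight (Γ := (γ : Γ) × Fin (input γ).n) hk.weaken (fun δ => hkle δ.1)
    hx.weaken (fun δ => hxle δ.1) hi.weaken (fun δ => hile δ.1) .var fun δ => val_le_bound δ.2
  exact forall_vertex ((mem_block (u := fun δ => δ.2) .var hk.weaken hj.weaken).imp
    ((le hwu.weaken hwt).imp (adj (u := fun δ => v δ.1) (v := fun δ => δ.2) hv.weaken .var)))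

theorem Decides.isChainCover_digitWeight (hk : Computes k) (hkle : ∀ γ, k γ ≤ (input γ).bound)
    (hj : Computes j) (hc : Computes c) (hcle : ∀ γ, c γ ≤ (input γ).bound) (hx : Computes x)
    (hxle : ∀ γ, x γ ≤ (input γ).bound) :
    Decides fun γ => IsChainCover (input γ).graph (minSimplicial (input γ).graph)ᶜ
      (block (input γ).graph (k γ) (j γ)) fun (i : Fin (c γ)) u => digitWeight (k γ) (x γ) i u := by
  have hv : Computes fun δ : (δ : (γ : Γ) × Fin (input γ).n) × Fin (input δ).n => (δ.1.2 : ℕ) :=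
    Computes.var.weaken
  exact forall_vertex ((mem_minSimplicial (u := fun δ => δ.2) .var).not.imp (forall_vertex
    ((mem_block (u := fun δ => δ.2) .var hk.weaken.weaken hj.weaken.weaken).imp
      ((adj (u := fun δ => δ.1.2) (v := fun δ => δ.2) hv .var).imp
        (exists_fin hc.weaken.weaken (fun δ => hcle δ.1.1) (forall_digitWeight_le_imp_adj
          (u := fun δ => δ.1.2) (v := fun δ => δ.1.1.2) hk.weaken.weaken.weaken
          (fun δ => hkle δ.1.1.1) hj.weaken.weaken.weaken hx.weaken.weaken.weaken
          (fun δ => hxle δ.1.1.1) .var (fun δ => δ.2.2.le.trans (hcle δ.1.1.1))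
          Computes.var.weaken hv.weaken))))))

namespace Computes

theorem chainCoverNumber_block (hk : Computes k) (hk0 : ∀ γ, 0 < k γ)
    (hkle : ∀ γ, k γ ^ (k γ * k γ) ≤ (input γ).bound) (hj : Computes j) :
    Computes fun γ => chainCoverNumber (input γ).graph (minSimplicial (input γ).graph)ᶜ
      (block (input γ).graph (k γ) (j γ)) := by
  have hkB (γ) : k γ ≤ (input γ).bound :=
    (Nat.le_self_pow (Nat.mul_pos (hk0 γ) (hk0 γ)).ne' _).trans (hkle γ)
  refine Computes.sInf hk hkB ((Decides.exists_fin bound.weaken (fun _ => le_rfl)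
    (Decides.isChainCover_digitWeight hk.weaken.weaken (fun δ => hkB δ.1.1) hj.weaken.weaken
      var.weaken (fun δ => δ.1.2.2.le.trans (hkB δ.1.1)) var fun δ => δ.2.2.le)).congr
    fun δ => ?_) fun γ => ?_
  · exact (exists_isChainCover_block_iff (hk0 δ.1) δ.2.2.le (hkle δ.1)).trans
      ⟨fun ⟨x, hx, h⟩ => ⟨⟨x, hx⟩, h⟩, fun ⟨x, h⟩ => ⟨x, x.2, h⟩⟩
  · exact ⟨_, (chainCoverNumber_le_ncard (Set.toFinite _)).trans (ncard_block_le (hk0 γ) (j γ)),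
      exists_isChainCover_chainCoverNumber (Set.toFinite _)⟩

theorem blockSize_bound : Computes fun γ : Γ => blockSize (input γ).bound := by
  refine findGreatest bound (fun _ => le_rfl) (.le (pow_mul ?_ ?_ ?_ ?_ ?_ ?_) bound.weaken)
  any_goals exact var.add (const 1)
  all_goals exact fun δ => δ.2.2

theorem approx (hk : Computes k) (hk0 : ∀ γ, 0 < k γ)
    (hkle : ∀ γ, k γ ^ (k γ * k γ) ≤ (input γ).bound) :
    Computes fun γ => approx (input γ).graph (k γ) :=
  sum ((div n (fun γ => (input γ).n_lt_bound.le) hk).add (const 1))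
    (fun γ => (Nat.div_le_self _ _).trans_lt (input γ).n_lt_bound)
    (chainCoverNumber_block hk.weaken (fun δ => hk0 δ.1) (fun δ => hkle δ.1) var)

end Computes

theorem Computes.exists_prog {f : Input → ℕ} (hf : Computes f) {c : ℕ} (hc : 0 < c) :
    ∃ (P : Prog) (p : Polynomial ℕ), ∀ (n : ℕ) (G : SimpleGraph (Fin n)), ∃ τ T,
      Exec P (graphInput G) τ T ∧ T ≤ p.eval n ∧
        τ.reg 0 = f ⟨n, G, n + c, Nat.lt_add_of_pos_right hc⟩ := by
  obtain ⟨p, hp⟩ := hf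
  obtain ⟨P, hP⟩ := hp id 2 le_rfl fun i hi => absurd hi i.not_lt_zero
  let setBound : Prog := .assign 1 (.add (.reg 0) (.const c))
  refine ⟨.seq (.seq setBound P) (.assign 0 (.reg 2)), 1 + p.comp (.X + .C c) + 1, fun n G => ?_⟩
  let I : Input := ⟨n, G, n + c, Nat.lt_add_of_pos_right hc⟩
  have hinput : Represents id ((graphInput G).setReg 1 (n + c)) I :=
    { n_eq := setReg_reg_of_ne zero_ne_one
      bound_eq := setReg_reg_self
      arr_eq := rfl
      value_eq := fun i hi => absurd hi i.not_lt_zero }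
  have hbound : HaltsWithin setBound (graphInput G) 1 (· = (graphInput G).setReg 1 (n + c)) :=
    haltsWithin_assign rfl
  have hprog : HaltsWithin (.seq setBound P) (graphInput G) (1 + p.eval (n + c))
      fun τ => τ.reg 2 = f I :=
    hbound.seq fun τ hτ => hτ ▸ (hP _ I hinput).mono le_rfl fun _ => And.left
  obtain ⟨τ, T, hexec, hT, hτ⟩ := hprog.seq fun τ hτ =>
    haltsWithin_assign (x := 0) (e := .reg 2) (Q := fun υ => υ.reg 0 = f I)
      (setReg_reg_self.trans hτ)
  exact ⟨τ, T, hexec, by simpa using hT, hτ⟩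

end Algorithm

end Ram

theorem mainTheorem4 (b : ℝ) (hb : 1 < b) :
    ∃ (P : Ram.Prog) (p : Polynomial ℕ),
      ∀ (n : ℕ) (G : SimpleGraph (Fin n)), G.IsSplitGraph →
        ∃ (τ : Ram.State) (T : ℕ),
          Ram.Exec P (Ram.graphInput G) τ T ∧ T ≤ p.eval n ∧
          G.thresholdDimension ≤ τ.reg 0 ∧
          (b < (n : ℝ) →
            τ.reg 0 ≤
              2 * ⌈(n : ℝ) * √(Real.logb b (Real.logb b n)) / √(Real.logb b n)⌉₊
                * G.thresholdDimension) := by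
  obtain ⟨c, hc, hratio⟩ := SplitGraph.exists_div_blockSize_add_one_le hb
  have bound_pos (I : Ram.Input) : 0 < I.bound := Nat.zero_lt_of_lt I.n_lt_bound
  have happrox : Ram.Computes fun I : Ram.Input =>
      SplitGraph.approx I.graph (SplitGraph.blockSize I.bound) :=
    .approx .blockSize_bound (fun I => SplitGraph.blockSize_pos (bound_pos I))
      fun I => SplitGraph.pow_blockSize_le (bound_pos I)
  obtain ⟨P, p, hP⟩ := happrox.exists_prog hc
  refine ⟨P, p, fun n G hG => ?_⟩
  obtain ⟨τ, T, hexec, hT, hτ⟩ := hP n G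
  refine ⟨τ, T, hexec, hT, ?_, fun hbn => ?_⟩
  · exact hτ ▸ SplitGraph.thresholdDimension_le_approx hG _
  · exact hτ ▸ (SplitGraph.approx_le G _).trans (Nat.mul_le_mul_right _ (hratio n hbn))
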